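/- Let $n\ge 1$, $Q=2n+2$, $2^*=\frac{2Q}{Q-2}$, and let $\mathbb S^{2n+1}$ be the unit sphere of $\mathbb C^{n+1}$ with (unnormalized) surface measure $d\xi$. Put $$T_j=\frac{\partial}{\partial \xi_j}-\overline{\xi_j}\sum_{k=1}^{n+1}\xi_k\frac{\partial}{\partial\xi_k},\qquad \overline{T_j}=\frac{\partial}{\partial\overline{\xi_j}}-\xi_j\sum_{k=1}^{n+1}\overline{\xi_k}\frac{\partial}{\partial\overline{\xi_k}}\qquad(1\le j\le n+1),$$ $$\mathcal E[u]=\frac12\int_{\mathbb S^{2n+1}}\Big(\sum_{j=1}^{n+1}\big(|T_ju|^2+|\overline{T_j}u|^2\big)+\frac{n^2}{2}|u|^2\Big)\,d\xi .$$ Let $S^1(\mathbb S^{2n+1})$ be the space of real-valued $u\in L^2$ with $\mathcal E[u]<\infty$, i.e. the completion of the smooth real-valued functions under the norm $\mathcal E[\cdot]^{1/2}$. Let $$\mathcal M_*=\Big\{\xi\mapsto \frac{c}{|1-\overline\eta\cdot\xi|^{(Q-2)/2}}\;:\; c\in\mathbb R,\ \eta\in\mathbb C^{n+1},\ |\eta|<1\Big\}$$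 be the set of real-valued extremal functions of the sharp Sobolev inequality $\mathcal E[u]\ge \big(\frac{Q-2}{4}\big)^2|\mathbb S^{2n+1}|^{2/Q}\|u\|_{L^{2^*}(\mathbb S^{2n+1})}^2$. For $u\in S^1(\mathbb S^{2n+1})$ with $\inf_{g\in\mathcal M_*}\mathcal E[u-g]>0$ set $$\mathcal S_*(u)=\frac{\mathcal E[u]-\big(\frac{Q-2}{4}\big)^2|\mathbb S^{2n+1}|^{2/Q}\,\|u\|_{L^{2^*}(\mathbb S^{2n+1})}^2}{\inf_{g\in\mathcal M_*}\mathcal E[u-g]}\in[0,\infty).$$ Let $C_{\rm BE}$ be the infimum of $\mathcal S_*(u)$ over all such $u$, and $C_{\rm BE}^{\rm pos}$ the infimum over all such $u$ that are nonnegative almost everywhere. Then $$C_{\rm BE}\ \ge\ \min\Big\{\tfrac12\,C_{\rm BE}^{\rm pos},\ 1-2^{-2/Q}\Big\}.$$ -/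

import Mathlib

open MeasureTheory Filter Topology
open scoped ENNReal ComplexConjugate

noncomputable section

namespace CRSphere

/-- The complex Euclidean space `ℂ^(n+1)`. -/
abbrev Amb (n : ℕ) : Type := EuclideanSpace ℂ (Fin (n + 1))

/-- The CR sphere `𝕊^(2n+1)`, the unit sphere of `ℂ^(n+1)`. -/
abbrev Sph (n : ℕ) : Type := Metric.sphere (0 : Amb n) 1

/-- The homogeneous dimension `Q = 2n + 2`. -/
def Q (n : ℕ) : ℝ := 2 * (n : ℝ) + 2

/-- The critical exponent `2^* = 2Q / (Q - 2)`. -/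
def critExp (n : ℕ) : ℝ := 2 * Q n / (Q n - 2)

/-- The surface measure `dξ` on the sphere (not normalized), induced by Lebesgue measure on
`ℂ^(n+1) = ℝ^(2n+2)`. -/
def σ (n : ℕ) : Measure (Sph n) := (volume : Measure (Amb n)).toSphere

/-- The Wirtinger derivative `∂φ/∂ξ_j` of a real-valued function. -/
def dz {n : ℕ} (φ : Amb n → ℝ) (j : Fin (n + 1)) (z : Amb n) : ℂ :=
  (1 / 2) * ((fderiv ℝ φ z (EuclideanSpace.single j 1) : ℂ)
    - Complex.I * (fderiv ℝ φ z (EuclideanSpace.single j Complex.I) : ℂ))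

/-- The Wirtinger derivative `∂φ/∂ξ̄_j` of a real-valued function. -/
def dzbar {n : ℕ} (φ : Amb n → ℝ) (j : Fin (n + 1)) (z : Amb n) : ℂ :=
  (1 / 2) * ((fderiv ℝ φ z (EuclideanSpace.single j 1) : ℂ)
    + Complex.I * (fderiv ℝ φ z (EuclideanSpace.single j Complex.I) : ℂ))

/-- The operator `T_j = ∂/∂ξ_j - ξ̄_j ∑ₖ ξ_k ∂/∂ξ_k`. It is tangential to the sphere, so on the
sphere it depends only on the restriction of `φ` to the sphere. -/
def T {n : ℕ} (j : Fin (n + 1)) (φ : Amb n → ℝ) (z : Amb n) : ℂ :=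
  dz φ j z - conj (z j) * ∑ k, z k * dz φ k z

/-- The operator `T̄_j = ∂/∂ξ̄_j - ξ_j ∑ₖ ξ̄_k ∂/∂ξ̄_k`. -/
def Tbar {n : ℕ} (j : Fin (n + 1)) (φ : Amb n → ℝ) (z : Amb n) : ℂ :=
  dzbar φ j z - z j * ∑ k, conj (z k) * dzbar φ k z

/-- A smooth function on the sphere, given by an extension that is smooth near the sphere. -/
def SmoothNearSphere {n : ℕ} (φ : Amb n → ℝ) : Prop :=
  ∀ ξ : Sph n, ContDiffAt ℝ ((⊤ : ℕ∞) : WithTop ℕ∞) φ ξ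

/-- `G = (T_j u)_j` and `H = (T̄_j u)_j` in the `L²` sense: some smooth functions converge to `u`
in `L²` together with their derivatives `T_j`, `T̄_j`, the latter to `G` and `H`. Thus `u` lies in
the completion of the smooth functions under the energy norm. -/
structure HasCRGradient {n : ℕ} (u : Sph n → ℝ) (G H : Fin (n + 1) → Sph n → ℂ) : Prop where
  memLp : MemLp u 2 (σ n)
  memLp_T : ∀ j, MemLp (G j) 2 (σ n)
  memLp_Tbar : ∀ j, MemLp (H j) 2 (σ n)
  approx : ∃ φ : ℕ → Amb n → ℝ, (∀ i, SmoothNearSphere (φ i)) ∧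
    Tendsto (fun i => eLpNorm (fun ξ : Sph n => φ i ξ - u ξ) 2 (σ n)) atTop (𝓝 0) ∧
    (∀ j, Tendsto (fun i => eLpNorm (fun ξ : Sph n => T j (φ i) ξ - G j ξ) 2 (σ n))
      atTop (𝓝 0)) ∧
    (∀ j, Tendsto (fun i => eLpNorm (fun ξ : Sph n => Tbar j (φ i) ξ - H j ξ) 2 (σ n))
      atTop (𝓝 0))

/-- The energy
`ℰ[u] = 1/2 ∫ (∑ⱼ (|T_j u|² + |T̄_j u|²) + n²/2 |u|²) dξ`.
The derivatives `G`, `H` of `u` are unique almost everywhere (by integration by parts), so the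
infimum only selects them; it is `∞` if `u` has no such derivatives in `L²`. -/
def energy {n : ℕ} (u : Sph n → ℝ) : ℝ≥0∞ :=
  ⨅ (G : Fin (n + 1) → Sph n → ℂ) (H : Fin (n + 1) → Sph n → ℂ) (_ : HasCRGradient u G H),
    ENNReal.ofReal (1 / 2) *
      ∫⁻ ξ, ((∑ j, (‖G j ξ‖ₑ ^ 2 + ‖H j ξ‖ₑ ^ 2))
        + ENNReal.ofReal ((n : ℝ) ^ 2 / 2) * ‖u ξ‖ₑ ^ 2) ∂(σ n)

/-- The space `S¹(𝕊^(2n+1))` of real-valued functions of finite energy. -/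
def S1 (n : ℕ) : Set (Sph n → ℝ) := {u | energy u < ∞}

/-- The real-valued extremal functions `c / |1 - η̄ · ξ|^((Q-2)/2)`, `c ∈ ℝ`, `|η| < 1`. -/
def extremals (n : ℕ) : Set (Sph n → ℝ) :=
  {g | ∃ (c : ℝ) (η : Amb n), ‖η‖ < 1 ∧
    ∀ ξ : Sph n, g ξ = c / ‖1 - inner ℂ η (ξ : Amb n)‖ ^ ((Q n - 2) / 2)}

/-- The squared distance `inf_g ℰ[u - g]` to the extremal functions. -/
def distSq {n : ℕ} (u : Sph n → ℝ) : ℝ≥0∞ := ⨅ g ∈ extremals n, energy (u - g)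

/-- The sharp constant `((Q-2)/4)² |𝕊^(2n+1)|^(2/Q)` of the Sobolev inequality
`ℰ[u] ≥ ((Q-2)/4)² |𝕊^(2n+1)|^(2/Q) ‖u‖²` in the critical Lebesgue norm. -/
def sobConst (n : ℕ) : ℝ≥0∞ :=
  ENNReal.ofReal (((Q n - 2) / 4) ^ 2) * (σ n Set.univ) ^ (2 / Q n)

/-- The quotient `𝒮_*(u)` of the Sobolev deficit by the squared distance, for `u` of finite energy
and `distSq u ≠ 0`. The deficit is nonnegative by the sharp Sobolev inequality, so the quotient is
written in `[0, ∞]`. -/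
def quot {n : ℕ} (u : Sph n → ℝ) : ℝ≥0∞ :=
  (energy u - sobConst n * eLpNorm u (ENNReal.ofReal (critExp n)) (σ n) ^ 2) / distSq u

/-- The optimal stability constant `C_BE`, the infimum of `𝒮_*` over the `u ∈ S¹` for which the
quotient is defined. -/
def CBE (n : ℕ) : ℝ≥0∞ := ⨅ u ∈ {u : Sph n → ℝ | u ∈ S1 n ∧ distSq u ≠ 0}, quot u

/-- The optimal stability constant `C_BE^pos` for nonnegative functions. -/
def CBEpos (n : ℕ) : ℝ≥0∞ :=
  ⨅ u ∈ {u : Sph n → ℝ | u ∈ S1 n ∧ distSq u ≠ 0 ∧ ∀ᵐ ξ ∂(σ n), 0 ≤ u ξ}, quot u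

end CRSphere

end

/-!
The argument compares `u` with its positive and negative parts. By Kato's formula
(`IsCRDeriv.abs`) the energy splits, `ℰ[u⁺] + ℰ[u⁻] ≤ ℰ[u]`
(`energy_posPart_add_energy_negPart_le`), whereas the critical norm does not. With
`A = ∫ (u⁺)^(2^*)`, `B = ∫ (u⁻)^(2^*)`, `θ = 1 - 2/Q = 2 / 2^*` one has
`(A + B)^θ ≤ A^θ + (2^θ - 1) B^θ` as soon as `B ≤ A`, by concavity (`rpow_add_le`), and `B ≤ A` may be
assumed after replacing `u` by `-u`. The Sobolev inequality for `u⁻` then leaves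
`(2 - 2^θ) ℰ[u⁻] = 2 (1 - 2^(-2/Q)) ℰ[u⁻]` in the deficit of `u`, besides the deficit of `u⁺`, which is
at least `C_BE^pos` times the squared distance of `u⁺` to the extremal functions. Since
`ℰ[u - g] ≤ 2 ℰ[u⁺ - g] + 2 ℰ[u⁻]`, both terms together control half the squared distance of `u`
(`stability_of_negPart_le`).

The sharp Sobolev inequality is needed only for nonnegative functions and only if `C_BE^pos ≠ 0`,
the claim being trivial otherwise. In that case it is contained in the definition of `C_BE^pos`, where
a negative deficit counts as `0`, except for functions at distance zero from the extremal functions.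
If such a function `v` had a negative deficit, then so would `v + ε w` for every smooth `w ≥ 0` and
small `ε`, since the energy is continuous along this line and the critical norm does not decrease. It
remains to choose `w` such that `v + ε w` has positive distance to the extremal functions
(`distSq_add_ne_zero`). The closure of the extremal functions consists of functions
`c / |1 - η̄ · ξ|^n` with `|η| ≤ 1`, and `|1 - η̄ · ξ|²` has the same sum over `± ξ` as over `± i ξ`.
This is incompatible with `w = (Im ξ₀)²`, which vanishes at the points `± e₀` but not at `± i e₀`
(`false_of_circle_identity`).
-/

namespace CRSphere

variable {n : ℕ}

/-! ### Tangential derivatives in the `L²` sense -/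

instance : IsFiniteMeasure (σ n) := by unfold σ; infer_instance

instance : (σ n).IsOpenPosMeasure := by unfold σ; infer_instance

theorem sigma_ne_zero : σ n ≠ 0 := Measure.toSphere_ne_zero _

/-- The real-linear form sending the differential `A` of a function at `z` to the value at `z` of
its tangential derivative: `T_j` for the index `inl j`, `T̄_j` for the index `inr j`. -/
noncomputable def crForm (s : Fin (n + 1) ⊕ Fin (n + 1)) (z : Amb n) (A : Amb n →L[ℝ] ℝ) : ℂ :=
  let a : Fin (n + 1) → ℂ := fun j => (A (EuclideanSpace.single j 1) : ℂ)
  let b : Fin (n + 1) → ℂ := fun j => (A (EuclideanSpace.single j Complex.I) : ℂ)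
  Sum.elim
    (fun j => (1 / 2) * (a j - Complex.I * b j)
      - conj (z j) * ∑ k, z k * ((1 / 2) * (a k - Complex.I * b k)))
    (fun j => (1 / 2) * (a j + Complex.I * b j)
      - z j * ∑ k, conj (z k) * ((1 / 2) * (a k + Complex.I * b k))) s

/-- The operators `T_j` (index `inl j`) and `T̄_j` (index `inr j`) as a single family. -/
noncomputable def crOp (s : Fin (n + 1) ⊕ Fin (n + 1)) (φ : Amb n → ℝ) (z : Amb n) : ℂ :=
  crForm s z (fderiv ℝ φ z)

theorem crForm_add (s : Fin (n + 1) ⊕ Fin (n + 1)) (z : Amb n) (A B : Amb n →L[ℝ] ℝ) :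
    crForm s z (A + B) = crForm s z A + crForm s z B := by
  rcases s with j | j <;>
  · simp only [crForm, Sum.elim_inl, Sum.elim_inr, add_apply, Complex.ofReal_add, mul_add, mul_sub,
      Finset.sum_add_distrib, Finset.sum_sub_distrib]
    ring

theorem crForm_smul (s : Fin (n + 1) ⊕ Fin (n + 1)) (z : Amb n) (c : ℝ) (A : Amb n →L[ℝ] ℝ) :
    crForm s z (c • A) = c * crForm s z A := by
  rcases s with j | j <;>
  · simp only [crForm, Sum.elim_inl, Sum.elim_inr, smul_apply, smul_eq_mul, Complex.ofReal_mul]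
    rw [mul_sub (c : ℂ)]
    congr 1
    · ring
    · simp only [Finset.mul_sum]
      exact Finset.sum_congr rfl fun k _ => by ring

theorem continuous_crForm (s : Fin (n + 1) ⊕ Fin (n + 1)) :
    Continuous fun p : Amb n × (Amb n →L[ℝ] ℝ) => crForm s p.1 p.2 := by
  rcases s with j | j <;>
  · simp only [crForm, Sum.elim_inl, Sum.elim_inr]
    fun_prop

namespace SmoothNearSphere

variable {φ ψ : Amb n → ℝ}

theorem differentiableAt (h : SmoothNearSphere φ) (ξ : Sph n) : DifferentiableAt ℝ φ ξ :=
  (h ξ).differentiableAt (by simp)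

theorem continuous (h : SmoothNearSphere φ) : Continuous fun ξ : Sph n => φ ξ :=
  continuous_iff_continuousAt.2 fun ξ => (h ξ).continuousAt.comp continuousAt_subtype_val

theorem continuous_crOp (h : SmoothNearSphere φ) (s : Fin (n + 1) ⊕ Fin (n + 1)) :
    Continuous fun ξ : Sph n => crOp s φ ξ := by
  have h1 : Continuous fun ξ : Sph n => fderiv ℝ φ ξ :=
    continuous_iff_continuousAt.2 fun ξ =>
      ((h ξ).continuousAt_fderiv (by simp)).comp continuousAt_subtype_val
  exact (continuous_crForm s).comp (continuous_subtype_val.prodMk h1)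

theorem add (h : SmoothNearSphere φ) (h' : SmoothNearSphere ψ) : SmoothNearSphere (φ + ψ) :=
  fun ξ => (h ξ).add (h' ξ)

theorem smul (c : ℝ) (h : SmoothNearSphere φ) : SmoothNearSphere (c • φ) :=
  fun ξ => (h ξ).const_smul c

theorem comp {f : ℝ → ℝ} (hf : ContDiff ℝ ((⊤ : ℕ∞) : WithTop ℕ∞) f) (h : SmoothNearSphere φ) :
    SmoothNearSphere (f ∘ φ) :=
  fun ξ => hf.contDiffAt.comp _ (h ξ)

theorem crOp_add (h : SmoothNearSphere φ) (h' : SmoothNearSphere ψ)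
    (s : Fin (n + 1) ⊕ Fin (n + 1)) (ξ : Sph n) :
    crOp s (φ + ψ) ξ = crOp s φ ξ + crOp s ψ ξ := by
  rw [crOp, fderiv_add (h.differentiableAt ξ) (h'.differentiableAt ξ), crForm_add]; rfl

theorem crOp_smul (c : ℝ) (h : SmoothNearSphere φ) (s : Fin (n + 1) ⊕ Fin (n + 1)) (ξ : Sph n) :
    crOp s (c • φ) ξ = c * crOp s φ ξ := by
  rw [crOp, fderiv_const_smul (h.differentiableAt ξ), crForm_smul]; rfl

theorem crOp_comp {f : ℝ → ℝ} (hf : Differentiable ℝ f) (h : SmoothNearSphere φ)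
    (s : Fin (n + 1) ⊕ Fin (n + 1)) (ξ : Sph n) :
    crOp s (f ∘ φ) ξ = deriv f (φ ξ) * crOp s φ ξ := by
  have h1 : fderiv ℝ (f ∘ φ) (ξ : Amb n) = deriv f (φ ξ) • fderiv ℝ φ (ξ : Amb n) :=
    ((hf (φ ξ)).hasDerivAt.comp_hasFDerivAt (ξ : Amb n) (h.differentiableAt ξ).hasFDerivAt).fderiv
  rw [crOp, h1, crForm_smul]; rfl

end SmoothNearSphere

/-- The `L²` error, for the function and all its tangential derivatives, made in replacing `u` with
derivatives `K` by the restriction of `φ`. -/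
noncomputable def crErr (φ : Amb n → ℝ) (u : Sph n → ℝ)
    (K : Fin (n + 1) ⊕ Fin (n + 1) → Sph n → ℂ) : ℝ≥0∞ :=
  eLpNorm (fun ξ : Sph n => φ ξ - u ξ) 2 (σ n)
    + ∑ s, eLpNorm (fun ξ : Sph n => crOp s φ ξ - K s ξ) 2 (σ n)

theorem eLpNorm_le_crErr (φ : Amb n → ℝ) (u : Sph n → ℝ)
    (K : Fin (n + 1) ⊕ Fin (n + 1) → Sph n → ℂ) :
    eLpNorm (fun ξ : Sph n => φ ξ - u ξ) 2 (σ n) ≤ crErr φ u K := le_self_add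

theorem eLpNorm_crOp_le_crErr (φ : Amb n → ℝ) (u : Sph n → ℝ)
    (K : Fin (n + 1) ⊕ Fin (n + 1) → Sph n → ℂ) (s : Fin (n + 1) ⊕ Fin (n + 1)) :
    eLpNorm (fun ξ : Sph n => crOp s φ ξ - K s ξ) 2 (σ n) ≤ crErr φ u K :=
  (Finset.single_le_sum (f := fun s => eLpNorm (fun ξ : Sph n => crOp s φ ξ - K s ξ) 2 (σ n))
    (fun _ _ => zero_le) (Finset.mem_univ s)).trans le_add_self

theorem tendsto_crErr_iff {ι : Type*} {l : Filter ι} {φ : ι → Amb n → ℝ} {u : Sph n → ℝ}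
    {K : Fin (n + 1) ⊕ Fin (n + 1) → Sph n → ℂ} :
    Tendsto (fun i => crErr (φ i) u K) l (𝓝 0) ↔
      Tendsto (fun i => eLpNorm (fun ξ : Sph n => φ i ξ - u ξ) 2 (σ n)) l (𝓝 0) ∧
      ∀ s, Tendsto (fun i => eLpNorm (fun ξ : Sph n => crOp s (φ i) ξ - K s ξ) 2 (σ n)) l
        (𝓝 0) := by
  constructor
  · intro h
    exact ⟨tendsto_of_tendsto_of_tendsto_of_le_of_le tendsto_const_nhds h (fun _ => zero_le)
      fun i => eLpNorm_le_crErr _ _ _, fun s =>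
      tendsto_of_tendsto_of_tendsto_of_le_of_le tendsto_const_nhds h (fun _ => zero_le)
      fun i => eLpNorm_crOp_le_crErr _ _ _ s⟩
  · rintro ⟨h1, h2⟩
    simpa [crErr] using h1.add (tendsto_finsetSum Finset.univ fun s _ => h2 s)

/-- `K` is a family of tangential derivatives of `u` in the `L²` sense, indexed as in `crOp`. It is
`HasCRGradient` with the two families of derivatives merged into one. -/
structure IsCRDeriv (u : Sph n → ℝ) (K : Fin (n + 1) ⊕ Fin (n + 1) → Sph n → ℂ) : Prop where
  memLp : MemLp u 2 (σ n)
  memLp_deriv : ∀ s, MemLp (K s) 2 (σ n)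
  approx : ∃ φ : ℕ → Amb n → ℝ, (∀ i, SmoothNearSphere (φ i)) ∧
    Tendsto (fun i => crErr (φ i) u K) atTop (𝓝 0)

theorem hasCRGradient_iff {u : Sph n → ℝ} {G H : Fin (n + 1) → Sph n → ℂ} :
    HasCRGradient u G H ↔ IsCRDeriv u (Sum.elim G H) := by
  constructor
  · rintro ⟨h1, h2, h3, φ, hφ, h4, h5, h6⟩
    exact ⟨h1, by rintro (j | j); exacts [h2 j, h3 j], φ, hφ,
      tendsto_crErr_iff.2 ⟨h4, by rintro (j | j); exacts [h5 j, h6 j]⟩⟩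
  · rintro ⟨h1, h2, φ, hφ, h⟩
    obtain ⟨h4, h5⟩ := tendsto_crErr_iff.1 h
    exact ⟨h1, fun j => h2 (.inl j), fun j => h2 (.inr j), φ, hφ, h4, fun j => h5 (.inl j),
      fun j => h5 (.inr j)⟩

/-- The energy of `u` computed with the tangential derivatives `K`. -/
noncomputable def energyWith (u : Sph n → ℝ) (K : Fin (n + 1) ⊕ Fin (n + 1) → Sph n → ℂ) : ℝ≥0∞ :=
  ENNReal.ofReal (1 / 2) *
    ∫⁻ ξ, ((∑ s, ‖K s ξ‖ₑ ^ 2) + ENNReal.ofReal ((n : ℝ) ^ 2 / 2) * ‖u ξ‖ₑ ^ 2) ∂(σ n)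

theorem energy_le_energyWith {u : Sph n → ℝ} {K : Fin (n + 1) ⊕ Fin (n + 1) → Sph n → ℂ}
    (h : IsCRDeriv u K) : energy u ≤ energyWith u K := by
  have h' : HasCRGradient u (fun j => K (.inl j)) (fun j => K (.inr j)) := by
    rw [hasCRGradient_iff]; convert h using 1; ext (j | j) <;> rfl
  refine (show energy u ≤ _ from
    iInf_le_of_le _ <| iInf_le_of_le _ <| iInf_le_of_le h' le_rfl).trans_eq ?_
  simp [energyWith, Fintype.sum_sum_type, Finset.sum_add_distrib]

theorem le_energy {u : Sph n → ℝ} {a : ℝ≥0∞}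
    (h : ∀ K, IsCRDeriv u K → a ≤ energyWith u K) : a ≤ energy u := by
  refine le_iInf fun G => le_iInf fun H => le_iInf fun hGH => ?_
  refine (h _ (hasCRGradient_iff.1 hGH)).trans_eq ?_
  simp [energyWith, Fintype.sum_sum_type, Finset.sum_add_distrib]

theorem energy_eq_iInf (u : Sph n → ℝ) :
    energy u = ⨅ K, ⨅ _ : IsCRDeriv u K, energyWith u K :=
  le_antisymm (le_iInf fun _ => le_iInf fun h => energy_le_energyWith h)
    (le_energy fun K h => iInf_le_of_le K (iInf_le _ h))

theorem exists_isCRDeriv_of_energy_lt {u : Sph n → ℝ} {a : ℝ≥0∞} (h : energy u < a) :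
    ∃ K, IsCRDeriv u K ∧ energyWith u K < a := by
  rw [energy_eq_iInf] at h
  simpa only [iInf_lt_iff, exists_prop] using h

theorem memLp_of_continuous {E : Type*} [NormedAddCommGroup E] {f : Sph n → E}
    (hf : Continuous f) (p : ℝ≥0∞) : MemLp f p (σ n) :=
  hf.memLp_of_hasCompactSupport (HasCompactSupport.of_compactSpace _)

theorem SmoothNearSphere.isCRDeriv {φ : Amb n → ℝ} (h : SmoothNearSphere φ) :
    IsCRDeriv (fun ξ : Sph n => φ ξ) (fun s ξ => crOp s φ ξ) :=
  ⟨memLp_of_continuous h.continuous 2, fun s => memLp_of_continuous (h.continuous_crOp s) 2,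
    fun _ => φ, fun _ => h, by simp [crErr]⟩

theorem tendsto_eLpNorm_triangle {α E : Type*} [MeasurableSpace α] {μ : Measure α}
    [NormedAddCommGroup E] {f g h : ℕ → α → E} (hf : ∀ i, AEStronglyMeasurable (f i) μ)
    (hg : ∀ i, AEStronglyMeasurable (g i) μ) (hh : ∀ i ξ, ‖h i ξ‖ ≤ ‖f i ξ + g i ξ‖)
    (hf0 : Tendsto (fun i => eLpNorm (f i) 2 μ) atTop (𝓝 0))
    (hg0 : Tendsto (fun i => eLpNorm (g i) 2 μ) atTop (𝓝 0)) :
    Tendsto (fun i => eLpNorm (h i) 2 μ) atTop (𝓝 0) :=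
  tendsto_of_tendsto_of_tendsto_of_le_of_le tendsto_const_nhds
    (by simpa using hf0.add hg0) (fun _ => zero_le) fun i =>
    (eLpNorm_mono (hh i)).trans (eLpNorm_add_le (hf i) (hg i) (by norm_num))

namespace IsCRDeriv

variable {u v : Sph n → ℝ} {K L : Fin (n + 1) ⊕ Fin (n + 1) → Sph n → ℂ}

/-- Tangential derivatives in the `L²` sense are stable under `L²` limits. -/
theorem of_tendsto {w : ℕ → Sph n → ℝ} {M : ℕ → Fin (n + 1) ⊕ Fin (n + 1) → Sph n → ℂ}
    (h : ∀ i, IsCRDeriv (w i) (M i)) (hu : MemLp u 2 (σ n)) (hK : ∀ s, MemLp (K s) 2 (σ n))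
    (hwu : Tendsto (fun i => eLpNorm (fun ξ => w i ξ - u ξ) 2 (σ n)) atTop (𝓝 0))
    (hMK : ∀ s, Tendsto (fun i => eLpNorm (fun ξ => M i s ξ - K s ξ) 2 (σ n)) atTop (𝓝 0)) :
    IsCRDeriv u K := by
  refine ⟨hu, hK, ?_⟩
  have hpos : ∀ i : ℕ, (0 : ℝ≥0∞) < ((i : ℝ≥0∞))⁻¹ := fun i => by simp
  have key : ∀ i : ℕ, ∃ φ : Amb n → ℝ, SmoothNearSphere φ ∧
      crErr φ (w i) (M i) < (i : ℝ≥0∞)⁻¹ := by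
    intro i
    obtain ⟨φ, hφ, hlim⟩ := (h i).approx
    obtain ⟨k, hk⟩ := (hlim.eventually_lt_const (hpos i)).exists
    exact ⟨φ k, hφ k, hk⟩
  choose φ hφ herr using key
  have h0 : Tendsto (fun i => crErr (φ i) (w i) (M i)) atTop (𝓝 0) :=
    tendsto_of_tendsto_of_tendsto_of_le_of_le tendsto_const_nhds
      ENNReal.tendsto_inv_nat_nhds_zero (fun _ => zero_le) fun i => (herr i).le
  have h1 : Tendsto (fun i => eLpNorm (fun ξ : Sph n => φ i ξ - w i ξ) 2 (σ n)) atTop (𝓝 0) :=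
    tendsto_of_tendsto_of_tendsto_of_le_of_le tendsto_const_nhds h0 (fun _ => zero_le)
      fun i => eLpNorm_le_crErr _ _ _
  have h2 : ∀ s, Tendsto (fun i => eLpNorm (fun ξ : Sph n => crOp s (φ i) ξ - M i s ξ) 2 (σ n))
      atTop (𝓝 0) := fun s =>
    tendsto_of_tendsto_of_tendsto_of_le_of_le tendsto_const_nhds h0 (fun _ => zero_le)
      fun i => eLpNorm_crOp_le_crErr _ _ _ s
  exact ⟨φ, hφ, tendsto_crErr_iff.2 ⟨tendsto_eLpNorm_triangle
    (fun i => (hφ i).continuous.aestronglyMeasurable.sub (h i).memLp.1)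
    (fun i => (h i).memLp.1.sub hu.1) (fun i ξ => le_of_eq (by simp)) h1 hwu,
    fun s => tendsto_eLpNorm_triangle
    (fun i => ((hφ i).continuous_crOp s).aestronglyMeasurable.sub ((h i).memLp_deriv s).1)
    (fun i => ((h i).memLp_deriv s).1.sub (hK s).1) (fun i ξ => le_of_eq (by simp)) (h2 s)
    (hMK s)⟩⟩

theorem add (hu : IsCRDeriv u K) (hv : IsCRDeriv v L) : IsCRDeriv (u + v) (K + L) := by
  obtain ⟨φ, hφ, h⟩ := hu.approx
  obtain ⟨ψ, hψ, h'⟩ := hv.approx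
  obtain ⟨h1, h2⟩ := tendsto_crErr_iff.1 h
  obtain ⟨h1', h2'⟩ := tendsto_crErr_iff.1 h'
  refine ⟨hu.memLp.add hv.memLp, fun s => (hu.memLp_deriv s).add (hv.memLp_deriv s),
    fun i => φ i + ψ i, fun i => (hφ i).add (hψ i), tendsto_crErr_iff.2 ⟨?_, fun s => ?_⟩⟩
  · exact tendsto_eLpNorm_triangle (fun i => (hφ i).continuous.aestronglyMeasurable.sub hu.memLp.1)
      (fun i => (hψ i).continuous.aestronglyMeasurable.sub hv.memLp.1)
      (fun i ξ => le_of_eq (by congr 1; simp only [Pi.add_apply, Pi.sub_apply]; ring)) h1 h1'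
  · exact tendsto_eLpNorm_triangle
      (fun i => ((hφ i).continuous_crOp s).aestronglyMeasurable.sub (hu.memLp_deriv s).1)
      (fun i => ((hψ i).continuous_crOp s).aestronglyMeasurable.sub (hv.memLp_deriv s).1)
      (fun i ξ => le_of_eq (by
        rw [(hφ i).crOp_add (hψ i)]; congr 1; simp only [Pi.add_apply, Pi.sub_apply]; ring)) (h2 s) (h2' s)

theorem smul (c : ℝ) (hu : IsCRDeriv u K) : IsCRDeriv (c • u) (fun s ξ => c * K s ξ) := by
  obtain ⟨φ, hφ, h⟩ := hu.approx
  obtain ⟨h1, h2⟩ := tendsto_crErr_iff.1 h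
  have lim {f : ℕ → ℝ≥0∞} (hf : Tendsto f atTop (𝓝 0)) :
      Tendsto (fun i => ‖c‖ₑ * f i) atTop (𝓝 0) := by
    simpa using ENNReal.Tendsto.const_mul hf (Or.inr (by simp : ‖c‖ₑ ≠ ∞))
  refine ⟨hu.memLp.const_smul c, fun s => (hu.memLp_deriv s).const_mul (c : ℂ),
    fun i => c • φ i, fun i => (hφ i).smul c, tendsto_crErr_iff.2 ⟨?_, fun s => ?_⟩⟩
  · refine (lim h1).congr fun i => ?_
    rw [← eLpNorm_const_smul]
    refine congrArg (fun f => eLpNorm f 2 (σ n)) (funext fun ξ => ?_)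
    simp only [Pi.smul_apply, smul_eq_mul]; ring
  · refine (lim (h2 s)).congr fun i => ?_
    rw [← eLpNorm_const_smul]
    refine congrArg (fun f => eLpNorm f 2 (σ n)) (funext fun ξ => ?_)
    rw [(hφ i).crOp_smul c]
    simp only [Pi.smul_apply, Complex.real_smul]; ring

end IsCRDeriv

/-! ### Chain rule and Kato's formula -/

theorem tendsto_eLpNorm_two_of_dominated {α E : Type*} [MeasurableSpace α] {μ : Measure α}
    [NormedAddCommGroup E] {f : ℕ → α → E} {g : α → E} (hf : ∀ i, AEStronglyMeasurable (f i) μ)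
    (hg : MemLp g 2 μ) {C : ℝ} (hbound : ∀ i, ∀ᵐ ξ ∂μ, ‖f i ξ‖ ≤ C * ‖g ξ‖)
    (hlim : ∀ᵐ ξ ∂μ, Tendsto (fun i => f i ξ) atTop (𝓝 0)) :
    Tendsto (fun i => eLpNorm (f i) 2 μ) atTop (𝓝 0) := by
  have hg' : MemLp (fun ξ => C * ‖g ξ‖) 2 μ := hg.norm.const_mul C
  have hfin : ∫⁻ ξ, ‖C * ‖g ξ‖‖ₑ ^ (2 : ℝ) ∂μ ≠ ∞ := by
    simpa using (lintegral_rpow_enorm_lt_top_of_eLpNorm_lt_top (by norm_num) (by norm_num)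
      hg'.2).ne
  have h := tendsto_lintegral_of_dominated_convergence'
    (F := fun i ξ => ‖f i ξ‖ₑ ^ (2 : ℝ)) (f := fun _ => 0) (μ := μ)
    (fun ξ => ‖C * ‖g ξ‖‖ₑ ^ (2 : ℝ))
    (fun i => (hf i).enorm.pow_const _) (fun i => by
      filter_upwards [hbound i] with ξ hξ
      gcongr
      exact enorm_le_iff_norm_le.2 (hξ.trans (le_abs_self _))) hfin
    (by
      filter_upwards [hlim] with ξ hξ
      have h1 : Tendsto (fun i => ‖f i ξ‖ₑ) atTop (𝓝 0) := by simpa using hξ.enorm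
      simpa using h1.ennrpow_const 2)
  have h2 := h.ennrpow_const (1 / 2)
  simp only [lintegral_zero] at h2
  rw [ENNReal.zero_rpow_of_pos (by norm_num)] at h2
  refine h2.congr fun i => ?_
  rw [eLpNorm_eq_lintegral_rpow_enorm_toReal (by norm_num) (by norm_num)]
  simp

namespace IsCRDeriv

variable {u v : Sph n → ℝ} {K L : Fin (n + 1) ⊕ Fin (n + 1) → Sph n → ℂ}

theorem exists_ae_approx (h : IsCRDeriv u K) : ∃ φ : ℕ → Amb n → ℝ, (∀ i, SmoothNearSphere (φ i)) ∧
    Tendsto (fun i => crErr (φ i) u K) atTop (𝓝 0) ∧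
    ∀ᵐ ξ : Sph n ∂(σ n), Tendsto (fun i => φ i ξ) atTop (𝓝 (u ξ)) := by
  obtain ⟨φ, hφ, hlim⟩ := h.approx
  have h1 := (tendsto_crErr_iff.1 hlim).1
  obtain ⟨ns, hns, hae⟩ := (tendstoInMeasure_of_tendsto_eLpNorm (two_ne_zero)
    (fun i => (hφ i).continuous.aestronglyMeasurable) h.memLp.1 h1).exists_seq_tendsto_ae
  exact ⟨fun i => φ (ns i), fun i => hφ _, hlim.comp hns.tendsto_atTop, hae⟩

/-- The chain rule for smooth functions of bounded derivative. -/
theorem comp {f : ℝ → ℝ} (hf : ContDiff ℝ ((⊤ : ℕ∞) : WithTop ℕ∞) f) (hf' : ∀ t, |deriv f t| ≤ 1)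
    (h : IsCRDeriv u K) : IsCRDeriv (fun ξ => f (u ξ)) (fun s ξ => ((deriv f (u ξ) : ℝ) : ℂ) * K s ξ) := by
  have hd : Differentiable ℝ f := hf.differentiable (by simp)
  have hcd : Continuous (deriv f) := hf.continuous_deriv (by simp)
  have hcd' : Continuous fun t => ((deriv f t : ℝ) : ℂ) := Complex.continuous_ofReal.comp hcd
  have hlip : ∀ x y, |f x - f y| ≤ |x - y| := fun x y => by
    simpa [Real.dist_eq] using (lipschitzWith_of_nnnorm_deriv_le (C := 1) hd
      fun t => by simpa [← NNReal.coe_le_coe] using hf' t).dist_le_mul x y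
  have hmeas : ∀ s, AEStronglyMeasurable (fun ξ => ((deriv f (u ξ) : ℝ) : ℂ) * K s ξ) (σ n) := fun s =>
    (hcd'.comp_aestronglyMeasurable h.memLp.1).mul (h.memLp_deriv s).1
  obtain ⟨φ, hφ, hlim, hae⟩ := h.exists_ae_approx
  obtain ⟨h1, h2⟩ := tendsto_crErr_iff.1 hlim
  refine ⟨?_, fun s => (h.memLp_deriv s).mono (hmeas s) (ae_of_all _ fun ξ => ?_),
    fun i => f ∘ φ i, fun i => (hφ i).comp hf, tendsto_crErr_iff.2 ⟨?_, fun s => ?_⟩⟩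
  · have h3 : MemLp (fun ξ => ‖u ξ‖ + |f 0|) 2 (σ n) := h.memLp.norm.add (memLp_const _)
    refine h3.mono' (hd.continuous.comp_aestronglyMeasurable h.memLp.1) (ae_of_all _ fun ξ => ?_)
    have := hlip (u ξ) 0
    rw [sub_zero] at this
    rw [Real.norm_eq_abs, Real.norm_eq_abs]
    have h4 := abs_add_le (f (u ξ) - f 0) (f 0)
    rw [sub_add_cancel] at h4
    linarith
  · rw [norm_mul, Complex.norm_real]
    exact mul_le_of_le_one_left (norm_nonneg _) (hf' _)
  · exact tendsto_of_tendsto_of_tendsto_of_le_of_le tendsto_const_nhds h1 (fun _ => zero_le)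
      fun i => eLpNorm_mono fun ξ => by
        simpa only [Real.norm_eq_abs, Function.comp_apply] using hlip (φ i ξ) (u ξ)
  · have m1 : ∀ i, AEStronglyMeasurable (fun ξ : Sph n => ((deriv f (φ i ξ) : ℝ) : ℂ)) (σ n) := fun i =>
      (hcd'.comp (hφ i).continuous).aestronglyMeasurable
    have m2 : AEStronglyMeasurable (fun ξ => ((deriv f (u ξ) : ℝ) : ℂ)) (σ n) :=
      hcd'.comp_aestronglyMeasurable h.memLp.1
    have m3 : ∀ i, AEStronglyMeasurable (fun ξ : Sph n => crOp s (φ i) ξ - K s ξ) (σ n) := fun i =>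
      ((hφ i).continuous_crOp s).aestronglyMeasurable.sub (h.memLp_deriv s).1
    refine tendsto_eLpNorm_triangle
      (f := fun i (ξ : Sph n) => ((deriv f (φ i ξ) : ℝ) : ℂ) * (crOp s (φ i) ξ - K s ξ))
      (g := fun i (ξ : Sph n) => (((deriv f (φ i ξ) : ℝ) : ℂ) - ((deriv f (u ξ) : ℝ) : ℂ)) * K s ξ)
      (fun i => (m1 i).mul (m3 i)) (fun i => ((m1 i).sub m2).mul (h.memLp_deriv s).1)
      (fun i ξ => le_of_eq ?_) ?_ ?_
    · rw [(hφ i).crOp_comp hd]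
      congr 1; ring
    · refine tendsto_of_tendsto_of_tendsto_of_le_of_le tendsto_const_nhds (h2 s)
        (fun _ => zero_le) fun i => eLpNorm_mono fun ξ => ?_
      rw [norm_mul, Complex.norm_real]
      exact mul_le_of_le_one_left (norm_nonneg _) (hf' _)
    · refine tendsto_eLpNorm_two_of_dominated (C := 2)
        (fun i => ((m1 i).sub m2).mul (h.memLp_deriv s).1) (h.memLp_deriv s)
        (fun i => ae_of_all _ fun ξ => ?_) ?_
      · rw [norm_mul]
        gcongr
        rw [← Complex.ofReal_sub, Complex.norm_real, Real.norm_eq_abs]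
        have := abs_sub (deriv f (φ i ξ)) (deriv f (u ξ))
        linarith [hf' (φ i ξ), hf' (u ξ)]
      · filter_upwards [hae] with ξ hξ
        have h5 := ((hcd'.tendsto (u ξ)).comp hξ).sub_const ((deriv f (u ξ) : ℝ) : ℂ)
        simpa using h5.mul_const (K s ξ)

/-- Kato's formula. The sign of `u` is written `u / |u|`, which is `0` where `u` vanishes. -/
theorem abs (h : IsCRDeriv u K) :
    IsCRDeriv (fun ξ => |u ξ|) (fun s ξ => ((u ξ / |u ξ| : ℝ) : ℂ) * K s ξ) := by
  -- The smooth functions `√(t² + δ²)` approximate `|t|` uniformly, with derivatives bounded by `1`.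
  let δ : ℕ → ℝ := fun i => 1 / ((i : ℝ) + 1)
  let f : ℕ → ℝ → ℝ := fun i t => √(t ^ 2 + δ i ^ 2)
  have hδ : ∀ i, 0 < δ i := fun i => by positivity
  have hδ0 : Tendsto δ atTop (𝓝 0) := tendsto_one_div_add_atTop_nhds_zero_nat
  have hpos : ∀ i t, 0 < t ^ 2 + δ i ^ 2 := fun i t => by have := hδ i; positivity
  have hf : ∀ i, ContDiff ℝ ((⊤ : ℕ∞) : WithTop ℕ∞) (f i) := fun i =>
    ContDiff.sqrt (by fun_prop) fun t => (hpos i t).ne'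
  have hderiv : ∀ i t, deriv (f i) t = t / √(t ^ 2 + δ i ^ 2) := fun i t => by
    have h1 : HasDerivAt (fun t : ℝ => t ^ 2 + δ i ^ 2) (2 * t) t := by
      simpa using (hasDerivAt_pow 2 t).add_const (δ i ^ 2)
    rw [(h1.sqrt (hpos i t).ne').deriv]
    have := Real.sqrt_pos.2 (hpos i t)
    field_simp
  have hf' : ∀ i t, |deriv (f i) t| ≤ 1 := fun i t => by
    rw [hderiv, abs_div, abs_of_pos (Real.sqrt_pos.2 (hpos i t)),
      div_le_one (Real.sqrt_pos.2 (hpos i t))]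
    exact Real.abs_le_sqrt (by nlinarith [hδ i])
  have hlim : ∀ t, Tendsto (fun i => deriv (f i) t) atTop (𝓝 (t / |t|)) := fun t => by
    rcases eq_or_ne t 0 with rfl | ht
    · simp [hderiv]
    simp only [hderiv]
    refine Tendsto.div tendsto_const_nhds ?_ (abs_ne_zero.2 ht)
    have := ((hδ0.pow 2).const_add (t ^ 2)).sqrt
    simpa [Real.sqrt_sq_eq_abs] using this
  have habs : ∀ t : ℝ, |(t / |t|)| ≤ 1 := fun t => by
    rw [abs_div, abs_abs]; exact div_self_le_one _
  have hsub : ∀ i t, |f i t - (|t|)| ≤ δ i := fun i t => by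
    have h1 : |t| ≤ f i t := Real.abs_le_sqrt (by nlinarith [hδ i])
    have h2 : f i t ≤ |t| + δ i := by
      refine (Real.sqrt_le_left (by have := hδ i; positivity)).2 ?_
      nlinarith [abs_nonneg t, hδ i, sq_abs t, mul_nonneg (abs_nonneg t) (hδ i).le]
    rw [abs_of_nonneg (sub_nonneg.2 h1)]; linarith
  have hlimC : ∀ s ξ, Tendsto (fun i => ((deriv (f i) (u ξ) : ℝ) : ℂ) * K s ξ) atTop
      (𝓝 (((u ξ / |u ξ| : ℝ) : ℂ) * K s ξ)) := fun s ξ =>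
    ((Complex.continuous_ofReal.tendsto _).comp (hlim (u ξ))).mul_const _
  have hi := fun i => h.comp (hf i) (hf' i)
  have hmeas : ∀ s, AEStronglyMeasurable (fun ξ => ((u ξ / |u ξ| : ℝ) : ℂ) * K s ξ) (σ n) :=
    fun s => aestronglyMeasurable_of_tendsto_ae atTop (fun i => ((hi i).memLp_deriv s).1)
      (ae_of_all _ fun ξ => hlimC s ξ)
  refine of_tendsto hi h.memLp.norm (fun s => (h.memLp_deriv s).mono (hmeas s)
    (ae_of_all _ fun ξ => ?_)) ?_ fun s => ?_
  · rw [norm_mul, Complex.norm_real]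
    exact mul_le_of_le_one_left (norm_nonneg _) (habs _)
  · have hone : MemLp (fun _ : Sph n => (1 : ℝ)) 2 (σ n) := memLp_const 1
    refine tendsto_eLpNorm_two_of_dominated (C := 1)
      (fun i => (hi i).memLp.1.sub h.memLp.norm.1) hone (fun i => ae_of_all _ fun ξ => ?_)
      (ae_of_all _ fun ξ => ?_)
    · refine (hsub i (u ξ)).trans ?_
      have : δ i ≤ 1 := by
        simp only [δ]
        rw [div_le_one (by positivity)]
        have : (0 : ℝ) ≤ i := by positivity
        linarith
      simpa using this
    · exact squeeze_zero_norm (fun i => hsub i (u ξ)) hδ0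
  · refine tendsto_eLpNorm_two_of_dominated (C := 2)
      (fun i => ((hi i).memLp_deriv s).1.sub (hmeas s)) (h.memLp_deriv s)
      (fun i => ae_of_all _ fun ξ => ?_) (ae_of_all _ fun ξ => ?_)
    · rw [← sub_mul, norm_mul]
      gcongr
      rw [← Complex.ofReal_sub, Complex.norm_real, Real.norm_eq_abs]
      have := abs_sub (deriv (f i) (u ξ)) (u ξ / |u ξ|)
      linarith [hf' i (u ξ), habs (u ξ)]
    · simpa using (hlimC s ξ).sub_const (((u ξ / |u ξ| : ℝ) : ℂ) * K s ξ)

end IsCRDeriv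

/-! ### Properties of the energy -/

/-- The integrand of `energyWith u K`. -/
noncomputable def energyDensity (u : Sph n → ℝ) (K : Fin (n + 1) ⊕ Fin (n + 1) → Sph n → ℂ)
    (ξ : Sph n) : ℝ≥0∞ :=
  (∑ s, ‖K s ξ‖ₑ ^ 2) + ENNReal.ofReal ((n : ℝ) ^ 2 / 2) * ‖u ξ‖ₑ ^ 2

theorem energyWith_eq (u : Sph n → ℝ) (K : Fin (n + 1) ⊕ Fin (n + 1) → Sph n → ℂ) :
    energyWith u K = ENNReal.ofReal (1 / 2) * ∫⁻ ξ, energyDensity u K ξ ∂(σ n) := rfl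

theorem energyDensity_mul (a : Sph n → ℝ) (u : Sph n → ℝ)
    (K : Fin (n + 1) ⊕ Fin (n + 1) → Sph n → ℂ) (ξ : Sph n) :
    energyDensity (fun ξ => a ξ * u ξ) (fun s ξ => (a ξ : ℂ) * K s ξ) ξ =
      ‖a ξ‖ₑ ^ 2 * energyDensity u K ξ := by
  have h : ‖(a ξ : ℂ)‖ₑ = ‖a ξ‖ₑ := by
    rw [← ofReal_norm, ← ofReal_norm, Complex.norm_real]
  simp only [energyDensity, enorm_mul, mul_pow, mul_add, Finset.mul_sum, h]
  rw [mul_left_comm]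

theorem IsCRDeriv.aemeasurable_energyDensity {u : Sph n → ℝ}
    {K : Fin (n + 1) ⊕ Fin (n + 1) → Sph n → ℂ} (h : IsCRDeriv u K) :
    AEMeasurable (energyDensity u K) (σ n) := by
  refine AEMeasurable.add ?_ ((h.memLp.1.enorm.pow_const 2).const_mul _)
  exact Finset.aemeasurable_fun_sum _ fun s _ => (h.memLp_deriv s).1.enorm.pow_const 2

theorem enorm_add_mul_sq_le {R : Type*} [SeminormedRing R] [NormedAlgebra ℝ R] (ε : NNReal)
    (a b : R) : ‖a + (ε : ℝ) • b‖ₑ ^ 2 ≤ (1 + ε) * (‖a‖ₑ ^ 2 + ε * ‖b‖ₑ ^ 2) := by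
  simp only [enorm_eq_nnnorm]
  norm_cast
  rw [← NNReal.coe_le_coe]
  push_cast
  have h1 : ‖a + (ε : ℝ) • b‖ ≤ ‖a‖ + ε * ‖b‖ := by
    refine (norm_add_le _ _).trans ?_
    rw [norm_smul, NNReal.norm_eq]
  have h2 : (‖a‖ + ε * ‖b‖) ^ 2 ≤ (1 + ε) * (‖a‖ ^ 2 + ε * ‖b‖ ^ 2) := by
    nlinarith [mul_nonneg ε.2 (sq_nonneg (‖a‖ - ‖b‖))]
  exact (pow_le_pow_left₀ (norm_nonneg _) h1 2).trans h2

/-- A quantitative form of the continuity of the energy along `u + ε v`, by `2ab ≤ a² + b²`. -/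
theorem energy_add_smul_le {ε : NNReal} (hε : ε ≠ 0) (u v : Sph n → ℝ) :
    energy (u + (ε : ℝ) • v) ≤ (1 + ε) * (energy u + ε * energy v) := by
  have key : ∀ K L, IsCRDeriv u K → IsCRDeriv v L →
      energy (u + (ε : ℝ) • v) ≤ (1 + ε) * (energyWith u K + ε * energyWith v L) := by
    intro K L hu hv
    refine (energy_le_energyWith (hu.add (hv.smul ε))).trans ?_
    have hpt : ∀ ξ, energyDensity (u + (ε : ℝ) • v) (K + fun s ξ => ((ε : ℝ) : ℂ) * L s ξ) ξ ≤
        (1 + ε) * (energyDensity u K ξ + ε * energyDensity v L ξ) := by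
      intro ξ
      have h1 := enorm_add_mul_sq_le ε (u ξ) (v ξ)
      have h2 : ∀ s, ‖K s ξ + ((ε : ℝ) : ℂ) * L s ξ‖ₑ ^ 2 ≤
          (1 + ε) * (‖K s ξ‖ₑ ^ 2 + ε * ‖L s ξ‖ₑ ^ 2) := fun s => by
        simpa only [Complex.real_smul] using enorm_add_mul_sq_le ε (K s ξ) (L s ξ)
      simp only [energyDensity, Pi.add_apply, Pi.smul_apply]
      calc _ ≤ ∑ s, (1 + ε) * (‖K s ξ‖ₑ ^ 2 + ε * ‖L s ξ‖ₑ ^ 2) +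
            ENNReal.ofReal ((n : ℝ) ^ 2 / 2) * ((1 + ε) * (‖u ξ‖ₑ ^ 2 + ε * ‖v ξ‖ₑ ^ 2)) := by
            gcongr with s _
            exact h2 s
        _ = _ := by
            rw [← Finset.mul_sum, Finset.sum_add_distrib, ← Finset.mul_sum]
            ring
    rw [energyWith_eq, energyWith_eq, energyWith_eq]
    calc _ ≤ ENNReal.ofReal (1 / 2) * ∫⁻ ξ, (1 + ε) * (energyDensity u K ξ
          + ε * energyDensity v L ξ) ∂(σ n) := by
          gcongr with ξ
          exact hpt ξ
      _ = _ := by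
          rw [lintegral_const_mul' _ _ (by simp),
            lintegral_add_left' hu.aemeasurable_energyDensity,
            lintegral_const_mul' _ _ ENNReal.coe_ne_top]
          ring
  rw [energy_eq_iInf u, energy_eq_iInf v, iInf_subtype', iInf_subtype',
    ENNReal.mul_iInf_of_ne (by simpa using hε) ENNReal.coe_ne_top, ENNReal.iInf_add,
    ENNReal.mul_iInf_of_ne (by simp) (by simp)]
  refine le_iInf fun K => ?_
  rw [ENNReal.add_iInf, ENNReal.mul_iInf_of_ne (by simp) (by simp)]
  exact le_iInf fun L => key K.1 L.1 K.2 L.2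

theorem energy_neg (u : Sph n → ℝ) : energy (-u) = energy u := by
  have key : ∀ u : Sph n → ℝ, energy (-u) ≤ energy u := by
    refine fun u => le_energy fun K hK => ?_
    have h := hK.smul (-1)
    refine ((energy_le_energyWith (u := -u) (by simpa using h)).trans_eq ?_)
    simp [energyWith]
  exact le_antisymm (key u) (by simpa using key (-u))

theorem energy_sub_le (u v : Sph n → ℝ) : energy (u - v) ≤ 2 * energy u + 2 * energy v := by
  have h := energy_add_smul_le (one_ne_zero) u (-v)
  rw [energy_neg] at h
  refine (le_of_eq ?_).trans (h.trans_eq ?_)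
  · simp [sub_eq_add_neg]
  · rw [ENNReal.coe_one, one_mul, one_add_one_eq_two, mul_add]

theorem SmoothNearSphere.energy_lt_top {φ : Amb n → ℝ} (h : SmoothNearSphere φ) :
    energy (fun ξ : Sph n => φ ξ) < ∞ := by
  refine (energy_le_energyWith h.isCRDeriv).trans_lt ?_
  have hfin : ∀ {E : Type} [NormedAddCommGroup E] {f : Sph n → E}, Continuous f →
      ∫⁻ ξ, ‖f ξ‖ₑ ^ 2 ∂(σ n) < ∞ := fun hf => by
    simpa using lintegral_rpow_enorm_lt_top_of_eLpNorm_lt_top (by norm_num) (by norm_num)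
      (memLp_of_continuous hf 2).2
  rw [energyWith]
  refine ENNReal.mul_lt_top ENNReal.ofReal_lt_top ?_
  have hm : ∀ s, AEMeasurable (fun ξ : Sph n => ‖crOp s φ ξ‖ₑ ^ 2) (σ n) := fun s =>
    (h.continuous_crOp s).aestronglyMeasurable.enorm.pow_const 2
  rw [lintegral_add_left' (Finset.aemeasurable_fun_sum _ fun s _ => hm s),
    lintegral_finsetSum' _ fun s _ => hm s, lintegral_const_mul' _ _ ENNReal.ofReal_ne_top]
  exact ENNReal.add_lt_top.2 ⟨ENNReal.sum_lt_top.2 fun s _ => hfin (h.continuous_crOp s),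
    ENNReal.mul_lt_top ENNReal.ofReal_lt_top (hfin h.continuous)⟩

theorem memLp_of_energy_lt_top {u : Sph n → ℝ} (h : energy u < ∞) : MemLp u 2 (σ n) := by
  obtain ⟨K, hK, -⟩ := exists_isCRDeriv_of_energy_lt h
  exact hK.memLp

theorem eLpNorm_sq_le_energy (u : Sph n → ℝ) :
    ENNReal.ofReal ((n : ℝ) ^ 2 / 4) * eLpNorm u 2 (σ n) ^ 2 ≤ energy u := by
  refine le_energy fun K hK => ?_
  have h1 : eLpNorm u 2 (σ n) ^ 2 = ∫⁻ ξ, ‖u ξ‖ₑ ^ 2 ∂(σ n) := by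
    simpa using eLpNorm_nnreal_pow_eq_lintegral (f := u) (μ := σ n) (p := 2) two_ne_zero
  have h2 : ENNReal.ofReal ((n : ℝ) ^ 2 / 4)
      = ENNReal.ofReal (1 / 2) * ENNReal.ofReal ((n : ℝ) ^ 2 / 2) := by
    rw [← ENNReal.ofReal_mul (by norm_num)]; congr 1; ring
  rw [h1, h2, mul_assoc, energyWith, ← lintegral_const_mul' _ _ ENNReal.ofReal_ne_top]
  gcongr
  exact le_add_self

/-- The energy splits over the positive and the negative part: by Kato's formula their derivatives
are those of `u` multiplied by `(1 + s) / 2` and `(s - 1) / 2`, `s` being the sign of `u`. Since `s`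
may vanish, the squares of these factors have sum at most `1`. -/
theorem energy_posPart_add_energy_negPart_le (u : Sph n → ℝ) :
    energy u⁺ + energy u⁻ ≤ energy u := by
  refine le_energy fun K hK => ?_
  let s : Sph n → ℝ := fun ξ => u ξ / |u ξ|
  let a : Sph n → ℝ := fun ξ => (1 + s ξ) / 2
  let b : Sph n → ℝ := fun ξ => (s ξ - 1) / 2
  have hcase : ∀ ξ, (s ξ = 1 ∧ 0 < u ξ) ∨ (s ξ = -1 ∧ u ξ < 0) ∨ (s ξ = 0 ∧ u ξ = 0) := by
    intro ξ
    rcases lt_trichotomy (u ξ) 0 with h | h | h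
    · right; left; exact ⟨by simp [s, abs_of_neg h, h.ne], h⟩
    · right; right; exact ⟨by simp [s, h], h⟩
    · left; exact ⟨by simp [s, abs_of_pos h, h.ne'], h⟩
  have hpos : IsCRDeriv (fun ξ => a ξ * u ξ) (fun j ξ => (a ξ : ℂ) * K j ξ) := by
    convert (hK.add hK.abs).smul (1 / 2) using 1
    · ext ξ
      rcases hcase ξ with ⟨h1, h2⟩ | ⟨h1, h2⟩ | ⟨h1, h2⟩ <;>
        simp [a, h1, h2, abs_of_pos, abs_of_neg]
      ring
    · ext j ξ
      simp [a, s]; ring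
  have hneg : IsCRDeriv (fun ξ => b ξ * u ξ) (fun j ξ => (b ξ : ℂ) * K j ξ) := by
    convert (hK.abs.add (hK.smul (-1))).smul (1 / 2) using 1
    · ext ξ
      rcases hcase ξ with ⟨h1, h2⟩ | ⟨h1, h2⟩ | ⟨h1, h2⟩ <;>
        simp [b, h1, h2, abs_of_pos, abs_of_neg]
      ring
    · ext j ξ
      simp [b, s]; ring
  have hup : u⁺ = fun ξ => a ξ * u ξ := by
    ext ξ
    rw [Pi.posPart_apply]
    rcases hcase ξ with ⟨h1, h2⟩ | ⟨h1, h2⟩ | ⟨h1, h2⟩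
    · simp [a, h1, posPart_of_nonneg h2.le]
    · simp [a, h1, posPart_of_nonpos h2.le]
    · simp [h2]
  have hun : u⁻ = fun ξ => b ξ * u ξ := by
    ext ξ
    rw [Pi.negPart_apply]
    rcases hcase ξ with ⟨h1, h2⟩ | ⟨h1, h2⟩ | ⟨h1, h2⟩
    · simp [b, h1, negPart_of_nonneg h2.le]
    · simp [b, h1, negPart_of_nonpos h2.le]; ring
    · simp [h2]
  have hab : ∀ ξ, ‖a ξ‖ₑ ^ 2 + ‖b ξ‖ₑ ^ 2 ≤ 1 := by
    intro ξ
    rw [← enorm_pow, ← enorm_pow, Real.enorm_eq_ofReal (sq_nonneg _),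
      Real.enorm_eq_ofReal (sq_nonneg _), ← ENNReal.ofReal_add (sq_nonneg _) (sq_nonneg _)]
    refine ENNReal.ofReal_le_one.2 ?_
    rcases hcase ξ with ⟨h1, h2⟩ | ⟨h1, h2⟩ | ⟨h1, h2⟩ <;> simp only [a, b, h1] <;> norm_num
  rw [hup, hun]
  refine (add_le_add (energy_le_energyWith hpos) (energy_le_energyWith hneg)).trans ?_
  rw [energyWith_eq, energyWith_eq, energyWith_eq, ← mul_add]
  gcongr
  refine (le_lintegral_add _ _).trans (lintegral_mono fun ξ => ?_)
  simp only [energyDensity_mul, ← add_mul]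
  exact mul_le_of_le_one_left zero_le (hab ξ)

/-! ### The closure of the extremal functions -/

theorem exponent_eq (n : ℕ) : (Q n - 2) / 2 = n := by unfold Q; ring

theorem zero_mem_extremals : (0 : Sph n → ℝ) ∈ extremals n :=
  ⟨0, 0, by simp, by simp⟩

theorem neg_mem_extremals {g : Sph n → ℝ} (h : g ∈ extremals n) : -g ∈ extremals n := by
  obtain ⟨c, η, hη, hg⟩ := h
  exact ⟨-c, η, hη, fun ξ => by rw [Pi.neg_apply, hg, neg_div]⟩

theorem distSq_le {u g : Sph n → ℝ} (hg : g ∈ extremals n) : distSq u ≤ energy (u - g) :=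
  iInf₂_le g hg

theorem distSq_le_energy (u : Sph n → ℝ) : distSq u ≤ energy u := by
  simpa using distSq_le (u := u) zero_mem_extremals

theorem distSq_neg (u : Sph n → ℝ) : distSq (-u) = distSq u := by
  have key : ∀ u : Sph n → ℝ, distSq (-u) ≤ distSq u := fun u =>
    le_iInf₂ fun g hg => (distSq_le (neg_mem_extremals hg)).trans_eq (by
      rw [← energy_neg (u - g)]; congr 1; abel)
  exact le_antisymm (key u) (by simpa using key (-u))

theorem mul_norm_pow_eq_of_extremal {c : ℝ} {η : Amb n} (hη : ‖η‖ < 1) {g : Sph n → ℝ}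
    (hg : ∀ ξ : Sph n, g ξ = c / ‖1 - inner ℂ η (ξ : Amb n)‖ ^ ((Q n - 2) / 2)) (ξ : Sph n) :
    g ξ * ‖1 - inner ℂ η (ξ : Amb n)‖ ^ n = c := by
  have h1 : ‖inner ℂ η (ξ : Amb n)‖ < 1 := by
    refine (norm_inner_le_norm _ _).trans_lt ?_
    rwa [mem_sphere_zero_iff_norm.1 ξ.2, mul_one]
  have h2 : ‖1 - inner ℂ η (ξ : Amb n)‖ ≠ 0 := by
    rw [norm_ne_zero_iff, sub_ne_zero]
    intro h
    rw [← h, norm_one] at h1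
    exact lt_irrefl _ h1
  rw [hg, exponent_eq, Real.rpow_natCast, div_mul_cancel₀ _ (pow_ne_zero _ h2)]

/-- A function at distance zero from the extremal functions is again of the form
`c / |1 - η̄ · ξ|^n` almost everywhere, where now `|η| = 1` is not excluded. Along a minimizing
sequence the parameters `η` have a limit point, and then the coefficients `c` converge because the
functions do so at almost every point. -/
theorem exists_ae_mul_norm_pow_eq (hn : 1 ≤ n) {u : Sph n → ℝ} (hu : energy u < ∞)
    (h : distSq u = 0) : ∃ (c : ℝ) (η : Amb n), ‖η‖ ≤ 1 ∧
      ∀ᵐ ξ : Sph n ∂(σ n), u ξ * ‖1 - inner ℂ η (ξ : Amb n)‖ ^ n = c := by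
  have hn' : 0 < ENNReal.ofReal ((n : ℝ) ^ 2 / 4) := by
    have : (1 : ℝ) ≤ n := by exact_mod_cast hn
    exact ENNReal.ofReal_pos.2 (by positivity)
  have hex : ∀ k : ℕ, ∃ g ∈ extremals n,
      energy (u - g) < ENNReal.ofReal ((n : ℝ) ^ 2 / 4) * ((k : ℝ≥0∞) + 1)⁻¹ ^ 2 := by
    intro k
    have hpos : distSq u < ENNReal.ofReal ((n : ℝ) ^ 2 / 4) * ((k : ℝ≥0∞) + 1)⁻¹ ^ 2 := by
      rw [h]
      exact ENNReal.mul_pos hn'.ne' (pow_ne_zero _ (by simp))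
    simpa only [distSq, iInf_lt_iff, exists_prop] using hpos
  choose g hg hlt using hex
  have hfin : ∀ k, energy (u - g k) < ∞ := fun k => (hlt k).trans_le le_top
  have hmem := memLp_of_energy_lt_top hu
  have hgm : ∀ k, AEStronglyMeasurable (g k) (σ n) := fun k => by
    simpa using hmem.1.sub (memLp_of_energy_lt_top (hfin k)).1
  have hle : ∀ k, eLpNorm (g k - u) 2 (σ n) ≤ ((k : ℝ≥0∞) + 1)⁻¹ := fun k => by
    have h1 := (eLpNorm_sq_le_energy (u - g k)).trans (hlt k).le
    rw [ENNReal.mul_le_mul_iff_right hn'.ne' ENNReal.ofReal_ne_top] at h1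
    rw [eLpNorm_sub_comm]
    exact (ENNReal.pow_le_pow_left_iff two_ne_zero).1 h1
  have hlim : Tendsto (fun k => eLpNorm (g k - u) 2 (σ n)) atTop (𝓝 0) := by
    refine tendsto_of_tendsto_of_tendsto_of_le_of_le tendsto_const_nhds ?_ (fun _ => zero_le) hle
    simpa using (tendsto_add_atTop_iff_nat 1).2 ENNReal.tendsto_inv_nat_nhds_zero
  obtain ⟨ns, -, hae⟩ := (tendstoInMeasure_of_tendsto_eLpNorm two_ne_zero hgm hmem.1
    hlim).exists_seq_tendsto_ae
  choose c η hη hgc using hg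
  obtain ⟨η₀, hη₀, ms, hms, hηlim⟩ := (isCompact_closedBall (0 : Amb n) 1).tendsto_subseq
    (x := fun k => η (ns k)) fun k => mem_closedBall_zero_iff.2 (hη _).le
  have hclim : ∀ᵐ ξ : Sph n ∂(σ n), Tendsto (fun k => c (ns (ms k))) atTop
      (𝓝 (u ξ * ‖1 - inner ℂ η₀ (ξ : Amb n)‖ ^ n)) := by
    filter_upwards [hae] with ξ hξ
    have h1 : Tendsto (fun k => ‖1 - inner ℂ (η (ns (ms k))) (ξ : Amb n)‖ ^ n) atTop
        (𝓝 (‖1 - inner ℂ η₀ (ξ : Amb n)‖ ^ n)) :=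
      (((hηlim.inner tendsto_const_nhds).const_sub 1).norm).pow n
    refine ((hξ.comp hms.tendsto_atTop).mul h1).congr fun k => ?_
    exact mul_norm_pow_eq_of_extremal (hη _) (hgc _) ξ
  have : (ae (σ n)).NeBot := ae_neBot.2 sigma_ne_zero
  obtain ⟨ξ₀, hξ₀⟩ := hclim.exists
  exact ⟨_, η₀, mem_closedBall_zero_iff.1 hη₀, hclim.mono fun ξ hξ => tendsto_nhds_unique hξ hξ₀⟩

/-- The functions `c / |1 - α z|^n` on the unit circle, `c ≥ 0`, are incompatible with the
perturbation `ε (Im z)²`: the denominators `|1 - α z|²` have the same sum over `z = ± 1` as over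
`z = ± i`, while the perturbation is felt only at the latter points. The relation is multiplied
by both denominators, so that it makes sense at their zeros. -/
theorem false_of_circle_identity (hn : n ≠ 0) {α β : ℂ} {c c' ε : ℝ} (hε : 0 < ε) (hc : 0 ≤ c)
    (hc' : 0 ≤ c') (h : ∀ z : ℂ, ‖z‖ = 1 →
      (c + ε * z.im ^ 2 * ‖1 - α * z‖ ^ n) * ‖1 - β * z‖ ^ n = c' * ‖1 - α * z‖ ^ n) : False := by
  have huniq : ∀ {γ z w : ℂ}, ‖1 - γ * z‖ = 0 → ‖1 - γ * w‖ = 0 → z = w := by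
    intro γ z w h1 h2
    rw [norm_eq_zero, sub_eq_zero] at h1 h2
    have hγ : γ ≠ 0 := by rintro rfl; simp at h1
    exact mul_left_cancel₀ hγ (h1.symm.trans h2)
  have hsum : ∀ γ : ℂ, ‖1 - γ * 1‖ ^ 2 + ‖1 - γ * (-1)‖ ^ 2 =
      ‖1 - γ * Complex.I‖ ^ 2 + ‖1 - γ * (-Complex.I)‖ ^ 2 := by
    intro γ
    simp only [Complex.sq_norm, Complex.normSq_apply]
    simp
    ring
  have h1 := h 1 (by simp)
  have h2 := h (-1) (by simp)
  have h3 := h Complex.I (by simp)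
  have h4 := h (-Complex.I) (by simp)
  simp only [Complex.one_im, Complex.neg_im, Complex.I_im, neg_zero, ne_eq, OfNat.ofNat_ne_zero,
    not_false_eq_true, zero_pow, mul_zero, zero_mul, add_zero, even_two, Even.neg_pow, one_pow,
    mul_one (ε : ℝ)] at h1 h2 h3 h4
  rcases hc'.eq_or_lt with rfl | hc'
  · rcases hc.eq_or_lt with rfl | hc
    · -- Off the real axis one of the two denominators has to vanish, but each does so at most once.
      have h5 : ∀ z : ℂ, ‖z‖ = 1 → z.im ≠ 0 → ‖1 - α * z‖ = 0 ∨ ‖1 - β * z‖ = 0 := by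
        intro z hz hz'
        have := h z hz
        simpa [hε.ne', hz', hn] using this
      have hp : ‖(3 / 5 + 4 / 5 * Complex.I : ℂ)‖ = 1 := by
        rw [← sq_eq_sq₀ (norm_nonneg _) zero_le_one, Complex.sq_norm, Complex.normSq_apply]
        norm_num
      have hI : Complex.I ≠ -Complex.I := fun e => by
        have := congrArg Complex.im e; norm_num at this
      have hI1 : Complex.I ≠ 3 / 5 + 4 / 5 * Complex.I := fun e => by
        have := congrArg Complex.im e; norm_num at this
      have hI2 : -Complex.I ≠ 3 / 5 + 4 / 5 * Complex.I := fun e => by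
        have := congrArg Complex.im e; norm_num at this
      rcases h5 Complex.I (by simp) (by simp) with h6 | h6 <;>
      rcases h5 (-Complex.I) (by simp) (by simp) with h7 | h7 <;>
      rcases h5 _ hp (by norm_num) with h8 | h8
      all_goals first
        | exact hI (huniq h6 h7)
        | exact hI1 (huniq h6 h8)
        | exact hI2 (huniq h7 h8)
    · have h5 : ‖1 - β * 1‖ = 0 := by simpa [hc.ne', hn] using h1
      have h6 : ‖1 - β * (-1)‖ = 0 := by simpa [hc.ne', hn] using h2
      have := huniq h5 h6
      norm_num at this
  · -- With `e ^ n = c / c'` the relation compares `|1 - α z|` with `e |1 - β z|`.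
    obtain ⟨e, he0, he⟩ : ∃ e : ℝ, 0 ≤ e ∧ e ^ n = c / c' :=
      ⟨(c / c') ^ ((n : ℝ)⁻¹), by positivity, Real.rpow_inv_natCast_pow (by positivity) hn⟩
    have hce : c = c' * e ^ n := by rw [he]; field_simp
    have heq : ∀ {x y : ℝ}, 0 ≤ x → 0 ≤ y → c * y ^ n = c' * x ^ n → x = e * y := by
      intro x y hx hy hxy
      rw [hce, mul_assoc, ← mul_pow] at hxy
      exact ((pow_left_inj₀ (by positivity) hx hn).1 (mul_left_cancel₀ hc'.ne' hxy)).symm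
    have hle : ∀ {x y : ℝ}, 0 ≤ x → 0 ≤ y → (c + ε * x ^ n) * y ^ n = c' * x ^ n → e * y ≤ x := by
      intro x y hx hy hxy
      have h5 : c' * (e * y) ^ n ≤ c' * x ^ n := by
        rw [mul_pow, ← mul_assoc, ← hce, ← hxy]
        gcongr
        have := mul_nonneg hε.le (pow_nonneg hx n)
        linarith
      exact (pow_le_pow_iff_left₀ (by positivity) hx hn).1 (le_of_mul_le_mul_left h5 hc')
    have e1 := heq (norm_nonneg _) (norm_nonneg _) h1
    have e2 := heq (norm_nonneg _) (norm_nonneg _) h2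
    have e3 := hle (norm_nonneg _) (norm_nonneg _) h3
    have e4 := hle (norm_nonneg _) (norm_nonneg _) h4
    have s1 := hsum α
    have s2 := hsum β
    rw [e1, e2, mul_pow, mul_pow, ← mul_add, s2, mul_add, ← mul_pow, ← mul_pow] at s1
    have q3 := pow_le_pow_left₀ (mul_nonneg he0 (norm_nonneg _)) e3 2
    have q4 := pow_le_pow_left₀ (mul_nonneg he0 (norm_nonneg _)) e4 2
    have hzero : ∀ {x y : ℝ}, 0 ≤ x → 0 ≤ y → x ^ 2 ≤ (e * y) ^ 2 →
        (c + ε * x ^ n) * y ^ n = c' * x ^ n → x = 0 := by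
      intro x y hx hy hxy hid
      have h5 : x = e * y := le_antisymm ((pow_le_pow_iff_left₀ hx (by positivity) two_ne_zero).1 hxy)
        (hle hx hy hid)
      have h6 : c' * x ^ n = c * y ^ n := by rw [h5, mul_pow, hce]; ring
      have h7 : ε * x ^ n * y ^ n = 0 := by linarith
      have h8 : x = 0 ∨ y = 0 := by simpa [hε.ne', hn] using h7
      rcases h8 with h8 | h8
      · exact h8
      · rw [h5, h8, mul_zero]
    have z3 := hzero (norm_nonneg _) (norm_nonneg _) (by linarith) h3
    have z4 := hzero (norm_nonneg _) (norm_nonneg _) (by linarith) h4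
    have := congrArg Complex.im (huniq z3 z4)
    norm_num at this

/-- The function `(Im ξ₀)²`, the square of one real coordinate. -/
def imSq (n : ℕ) (z : Amb n) : ℝ := (z 0).im ^ 2

theorem smoothNearSphere_imSq : SmoothNearSphere (imSq n) := by
  have h : ContDiff ℝ ((⊤ : ℕ∞) : WithTop ℕ∞) (imSq n) :=
    (((Complex.imCLM.comp ((EuclideanSpace.proj 0 : Amb n →L[ℂ] ℂ).restrictScalars ℝ))).contDiff).pow 2
  exact fun ξ => h.contDiffAt

/-- Perturbing by `ε (Im ξ₀)²` leads out of the closure of the nonnegative extremal functions. -/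
theorem distSq_add_ne_zero (hn : 1 ≤ n) {v : Sph n → ℝ} (hv : energy v < ∞)
    (hv0 : ∀ᵐ ξ ∂(σ n), 0 ≤ v ξ) {ε : ℝ} (hε : 0 < ε)
    (hfin : energy (v + ε • fun ξ : Sph n => imSq n ξ) < ∞) (h : distSq v = 0) :
    distSq (v + ε • fun ξ : Sph n => imSq n ξ) ≠ 0 := by
  intro h'
  obtain ⟨c, η, -, hc⟩ := exists_ae_mul_norm_pow_eq hn hv h
  obtain ⟨c', η', -, hc'⟩ := exists_ae_mul_norm_pow_eq hn hfin h'
  simp only [Pi.add_apply, Pi.smul_apply, smul_eq_mul] at hc'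
  have : (ae (σ n)).NeBot := ae_neBot.2 sigma_ne_zero
  obtain ⟨ξ₁, h1, h2, h3⟩ := (hv0.and (hc.and hc')).exists
  have hc0 : 0 ≤ c := by rw [← h2]; positivity
  have hc0' : 0 ≤ c' := by
    have : 0 ≤ imSq n ξ₁ := sq_nonneg _
    rw [← h3]; positivity
  have hid : (fun ξ : Sph n => (c + ε * imSq n ξ * ‖1 - inner ℂ η (ξ : Amb n)‖ ^ n) *
      ‖1 - inner ℂ η' (ξ : Amb n)‖ ^ n) =
      fun ξ : Sph n => c' * ‖1 - inner ℂ η (ξ : Amb n)‖ ^ n := by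
    have hcont : ∀ η : Amb n, Continuous fun ξ : Sph n => ‖1 - inner ℂ η (ξ : Amb n)‖ ^ n :=
      fun η => by fun_prop
    refine (Continuous.ae_eq_iff_eq (σ n) ?_ ?_).1 ?_
    · exact (continuous_const.add ((continuous_const.mul smoothNearSphere_imSq.continuous).mul
        (hcont η))).mul (hcont η')
    · exact continuous_const.mul (hcont η)
    · filter_upwards [hc, hc'] with ξ h4 h5
      rw [← h4, ← h5]; ring
  refine false_of_circle_identity (n := n) (by omega) (α := conj (η 0)) (β := conj (η' 0)) hε hc0 hc0'
    fun z hz => ?_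
  have h6 := congrFun hid ⟨EuclideanSpace.single 0 z, by simp [hz]⟩
  simpa [imSq, EuclideanSpace.inner_single_right, mul_comm] using h6

/-! ### Stability for functions of variable sign -/

/-- The integral `∫ |u|^(2^*)`. -/
noncomputable def critInt (u : Sph n → ℝ) : ℝ≥0∞ := ∫⁻ ξ, ‖u ξ‖ₑ ^ critExp n ∂(σ n)

theorem critExp_eq (hn : 1 ≤ n) : critExp n = 2 / (1 - 2 / Q n) := by
  have : (1 : ℝ) ≤ n := by exact_mod_cast hn
  unfold critExp Q
  have h1 : 2 * (n : ℝ) + 2 ≠ 0 := by positivity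
  have h2 : 2 * (n : ℝ) + 2 - 2 ≠ 0 := by simp; omega
  field_simp

theorem one_sub_two_div_Q_mem (hn : 1 ≤ n) : 0 < 1 - 2 / Q n ∧ 1 - 2 / Q n < 1 := by
  have : (1 : ℝ) ≤ n := by exact_mod_cast hn
  have hQ : 2 < Q n := by unfold Q; linarith
  constructor
  · rw [sub_pos, div_lt_one (by linarith)]; exact hQ
  · have : 0 < 2 / Q n := by positivity
    linarith

theorem critExp_pos (hn : 1 ≤ n) : 0 < critExp n := by
  rw [critExp_eq hn]
  exact div_pos two_pos (one_sub_two_div_Q_mem hn).1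

theorem eLpNorm_critExp_sq (hn : 1 ≤ n) (u : Sph n → ℝ) :
    eLpNorm u (ENNReal.ofReal (critExp n)) (σ n) ^ 2 = critInt u ^ (1 - 2 / Q n) := by
  have hp := critExp_pos hn
  rw [eLpNorm_eq_lintegral_rpow_enorm_toReal (by simpa using hp) ENNReal.ofReal_ne_top,
    ENNReal.toReal_ofReal hp.le, ← ENNReal.rpow_natCast, ← ENNReal.rpow_mul, critInt]
  congr 1
  have := (one_sub_two_div_Q_mem hn).1
  rw [critExp_eq hn]
  push_cast
  field_simp

theorem critInt_eq_add (hn : 1 ≤ n) {u : Sph n → ℝ} (hu : AEStronglyMeasurable u (σ n)) :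
    critInt u = critInt u⁺ + critInt u⁻ := by
  have hp := critExp_pos hn
  have hu' : AEStronglyMeasurable u⁺ (σ n) :=
    (continuous_id.max continuous_const).comp_aestronglyMeasurable hu
  rw [critInt, critInt, critInt, ← lintegral_add_left' (hu'.enorm.pow_const _)]
  refine lintegral_congr fun ξ => ?_
  rw [Pi.posPart_apply, Pi.negPart_apply]
  rcases le_total 0 (u ξ) with h | h
  · simp [posPart_of_nonneg h, negPart_of_nonneg h, hp]
  · simp [posPart_of_nonpos h, negPart_of_nonpos h, hp]

theorem sobConst_ne_zero (hn : 1 ≤ n) : sobConst n ≠ 0 := by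
  have : (1 : ℝ) ≤ n := by exact_mod_cast hn
  refine mul_ne_zero ?_ ?_
  · have h : 0 < (Q n - 2) / 4 := by unfold Q; linarith
    exact (ENNReal.ofReal_pos.2 (pow_pos h 2)).ne'
  · have h : σ n Set.univ ≠ 0 := by simpa using sigma_ne_zero
    simp [h, measure_ne_top]

/-- By concavity, the power of a sum falls short of the sum of the powers by a fixed fraction
of the smaller one. -/
theorem rpow_add_le {θ : ℝ} (hθ : 0 < θ) (hθ1 : θ ≤ 1) {A B : ℝ≥0∞} (hA : A ≠ ∞) (hBA : B ≤ A) :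
    (A + B) ^ θ ≤ A ^ θ + ENNReal.ofReal (2 ^ θ - 1) * B ^ θ := by
  lift A to NNReal using hA
  lift B to NNReal using ne_top_of_le_ne_top ENNReal.coe_ne_top hBA
  have hBA : (B : ℝ) ≤ A := by exact_mod_cast hBA
  have hr : (1 : ℝ) ≤ 2 ^ θ := Real.one_le_rpow one_le_two hθ.le
  have key : ((A : ℝ) + B) ^ θ ≤ (A : ℝ) ^ θ + (2 ^ θ - 1) * (B : ℝ) ^ θ := by
    rcases A.coe_nonneg.eq_or_lt with h | h
    · have hB : (B : ℝ) = 0 := le_antisymm (by rw [h]; exact hBA) B.coe_nonneg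
      simp [← h, hB, Real.zero_rpow hθ.ne']
    -- `A` and `2 B` are complementary convex combinations of `A + B` and `B`.
    have hc := Real.concaveOn_rpow hθ.le hθ1
    have m1 : (A : ℝ) + B ∈ Set.Ici (0 : ℝ) := Set.mem_Ici.2 (by positivity)
    have m2 : (B : ℝ) ∈ Set.Ici (0 : ℝ) := B.coe_nonneg
    have p1 : 0 ≤ ((A : ℝ) - B) / A := div_nonneg (sub_nonneg.2 hBA) h.le
    have p2 : 0 ≤ (B : ℝ) / A := div_nonneg B.coe_nonneg h.le
    have h1 := hc.2 m1 m2 p1 p2 (by field_simp; ring)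
    have h2 := hc.2 m1 m2 p2 p1 (by field_simp; ring)
    have e1 : (((A : ℝ) - B) / A) • ((A : ℝ) + B) + ((B : ℝ) / A) • (B : ℝ) = A := by
      simp only [smul_eq_mul]; field_simp; ring
    have e2 : ((B : ℝ) / A) • ((A : ℝ) + B) + (((A : ℝ) - B) / A) • (B : ℝ) = 2 * B := by
      simp only [smul_eq_mul]; field_simp; ring
    simp only [e1] at h1
    simp only [e2] at h2
    rw [Real.mul_rpow two_pos.le B.coe_nonneg] at h2
    simp only [smul_eq_mul] at h1 h2
    have e3 : ((A : ℝ) - B) / A = 1 - B / A := by field_simp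
    rw [e3] at h1 h2
    nlinarith
  rw [← ENNReal.coe_add, ← ENNReal.coe_rpow_of_nonneg _ hθ.le, ← ENNReal.coe_rpow_of_nonneg _ hθ.le,
    ← ENNReal.coe_rpow_of_nonneg _ hθ.le, ENNReal.ofReal, ← ENNReal.coe_mul, ← ENNReal.coe_add,
    ENNReal.coe_le_coe, ← NNReal.coe_le_coe]
  push_cast
  rwa [Real.coe_toNNReal _ (by linarith)]

/-- If `C_BE^pos` does not vanish, then it is a stability constant for all nonnegative functions,
and in particular these satisfy the sharp Sobolev inequality. For functions at distance zero from the
extremal functions, where the quotient says nothing, a negative deficit would persist under a small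
nonnegative perturbation leading out of the closure of the extremal functions, and so would make
`C_BE^pos` vanish. -/
theorem sobolev_add_CBEpos_mul_distSq_le (hn : 1 ≤ n) (hC : CBEpos n ≠ 0) {v : Sph n → ℝ}
    (hv : energy v < ∞) (hv0 : ∀ᵐ ξ ∂(σ n), 0 ≤ v ξ) :
    sobConst n * eLpNorm v (ENNReal.ofReal (critExp n)) (σ n) ^ 2 + CBEpos n * distSq v
      ≤ energy v := by
  have hquot : ∀ v : Sph n → ℝ, energy v < ∞ → (∀ᵐ ξ ∂(σ n), 0 ≤ v ξ) → distSq v ≠ 0 →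
      sobConst n * eLpNorm v (ENNReal.ofReal (critExp n)) (σ n) ^ 2 + CBEpos n * distSq v
        ≤ energy v := by
    intro v hv hv0 hd
    have h1 : CBEpos n ≤ quot v := iInf₂_le v ⟨hv, hd, hv0⟩
    have h2 := ENNReal.mul_le_of_le_div h1
    rcases lt_or_ge (sobConst n * eLpNorm v (ENNReal.ofReal (critExp n)) (σ n) ^ 2) (energy v)
      with h3 | h3
    · rw [← add_tsub_cancel_of_le h3.le]
      gcongr
    · refine absurd (le_antisymm ?_ zero_le) hC
      rwa [quot, tsub_eq_zero_of_le h3, ENNReal.zero_div] at h1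
  by_cases hd : distSq v = 0
  swap
  · exact hquot v hv hv0 hd
  rw [hd, mul_zero, add_zero]
  by_contra! hlt
  let w : Sph n → ℝ := fun ξ => imSq n ξ
  have hw : energy w < ∞ := smoothNearSphere_imSq.energy_lt_top
  have hlim : Tendsto (fun t : NNReal => (1 + (t : ℝ≥0∞)) * (energy v + t * energy w)) (𝓝[>] 0)
      (𝓝 (energy v)) := by
    have ht : Tendsto (fun t : NNReal => (t : ℝ≥0∞)) (𝓝[>] 0) (𝓝 0) :=
      (ENNReal.tendsto_coe.2 (tendsto_id (x := 𝓝 (0 : NNReal)))).mono_left nhdsWithin_le_nhds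
    have h1 := (ENNReal.Tendsto.mul_const ht (Or.inr hw.ne)).const_add (energy v)
    have h2 := ENNReal.Tendsto.mul (ht.const_add 1) (by simp) h1 (by simp)
    simpa using h2
  obtain ⟨t, ht, ht0⟩ := ((hlim.eventually_lt_const hlt).and self_mem_nhdsWithin).exists
  have ht0' : 0 < t := ht0
  have hE : energy (v + (t : ℝ) • w) <
      sobConst n * eLpNorm v (ENNReal.ofReal (critExp n)) (σ n) ^ 2 :=
    (energy_add_smul_le ht0'.ne' v w).trans_lt ht
  have hw0 : ∀ ξ, 0 ≤ (t : ℝ) * w ξ := fun ξ => mul_nonneg t.2 (sq_nonneg _)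
  have hmono : eLpNorm v (ENNReal.ofReal (critExp n)) (σ n) ≤
      eLpNorm (v + (t : ℝ) • w) (ENNReal.ofReal (critExp n)) (σ n) := by
    refine eLpNorm_mono_ae ?_
    filter_upwards [hv0] with ξ hξ
    rw [Pi.add_apply, Pi.smul_apply, smul_eq_mul, Real.norm_of_nonneg hξ,
      Real.norm_of_nonneg (add_nonneg hξ (hw0 ξ))]
    linarith [hw0 ξ]
  have hfin : energy (v + (t : ℝ) • w) < ∞ := hE.trans_le le_top
  have h1 := hquot (v + (t : ℝ) • w) hfin
    (hv0.mono fun ξ hξ => add_nonneg hξ (hw0 ξ))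
    (distSq_add_ne_zero hn hv hv0 (NNReal.coe_pos.2 ht0') hfin hd)
  refine absurd ((le_self_add.trans h1).trans_lt hE) (not_lt.2 ?_)
  gcongr

theorem distSq_le_posPart_negPart (u : Sph n → ℝ) :
    distSq u ≤ 2 * distSq u⁺ + 2 * energy u⁻ := by
  rw [distSq, distSq, ENNReal.mul_iInf_of_ne two_ne_zero ENNReal.ofNat_ne_top, ENNReal.iInf_add]
  refine le_iInf fun g => ?_
  by_cases hg : g ∈ extremals n
  · simp only [hg, iInf_pos]
    refine (iInf₂_le g hg).trans ((le_of_eq ?_).trans (energy_sub_le (u⁺ - g) u⁻))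
    congr 1
    nth_rewrite 1 [← posPart_sub_negPart u]
    abel
  · simp [hg]

theorem two_mul_ofReal_add_ofReal (hn : 1 ≤ n) :
    2 * ENNReal.ofReal (1 - (2 : ℝ) ^ (-2 / Q n))
      + ENNReal.ofReal ((2 : ℝ) ^ (1 - 2 / Q n) - 1) = 1 := by
  have hθ := one_sub_two_div_Q_mem hn
  have h1 : (2 : ℝ) ^ (1 - 2 / Q n) = 2 * 2 ^ (-2 / Q n) := by
    rw [sub_eq_add_neg, Real.rpow_add two_pos, Real.rpow_one, neg_div]
  have h2 : (1 : ℝ) ≤ 2 ^ (1 - 2 / Q n) := Real.one_le_rpow one_le_two hθ.1.le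
  have h3 : (2 : ℝ) ^ (-2 / Q n) ≤ 1 := by
    refine Real.rpow_le_one_of_one_le_of_nonpos one_le_two ?_
    rw [neg_div]
    linarith [hθ.2]
  rw [← ENNReal.ofReal_ofNat, ← ENNReal.ofReal_mul zero_le_two,
    ← ENNReal.ofReal_add (by linarith) (by linarith), h1, ← ENNReal.ofReal_one]
  congr 1
  ring

/-- The stability inequality for a function whose negative part has the smaller critical norm. -/
theorem stability_of_negPart_le (hn : 1 ≤ n) (hC : CBEpos n ≠ 0) {M : ℝ≥0∞}
    (hM : M * 2 ≤ CBEpos n) (hM' : M ≤ ENNReal.ofReal (1 - (2 : ℝ) ^ (-2 / Q n)))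
    {u : Sph n → ℝ} (hu : energy u < ∞) (hAB : critInt u⁻ ≤ critInt u⁺) :
    M * distSq u + sobConst n * eLpNorm u (ENNReal.ofReal (critExp n)) (σ n) ^ 2 ≤ energy u := by
  have hsplit := energy_posPart_add_energy_negPart_le u
  have hp := sobolev_add_CBEpos_mul_distSq_le hn hC
    ((le_self_add.trans hsplit).trans_lt hu) (ae_of_all _ fun ξ => posPart_nonneg u ξ)
  have hm := sobolev_add_CBEpos_mul_distSq_le hn hC
    ((le_add_self.trans hsplit).trans_lt hu) (ae_of_all _ fun ξ => negPart_nonneg u ξ)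
  rw [eLpNorm_critExp_sq hn] at hp hm ⊢
  have hm := le_self_add.trans hm
  have hθ := one_sub_two_div_Q_mem hn
  have hA : critInt u⁺ ≠ ∞ := by
    intro h
    rw [h, ENNReal.top_rpow_of_pos hθ.1, ENNReal.mul_top (sobConst_ne_zero hn), top_add] at hp
    exact (((le_self_add.trans hsplit).trans_lt hu).trans_le hp).false
  set κ := ENNReal.ofReal (1 - (2 : ℝ) ^ (-2 / Q n))
  set r := ENNReal.ofReal ((2 : ℝ) ^ (1 - 2 / Q n) - 1)
  set S := sobConst n
  have hd : M * distSq u ≤ CBEpos n * distSq u⁺ + 2 * κ * energy u⁻ := by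
    calc M * distSq u ≤ M * (2 * distSq u⁺ + 2 * energy u⁻) := by
          gcongr; exact distSq_le_posPart_negPart u
      _ = M * 2 * distSq u⁺ + 2 * M * energy u⁻ := by ring
      _ ≤ _ := by gcongr
  calc M * distSq u + S * critInt u ^ (1 - 2 / Q n)
      ≤ (CBEpos n * distSq u⁺ + 2 * κ * energy u⁻)
        + S * (critInt u⁺ ^ (1 - 2 / Q n) + r * critInt u⁻ ^ (1 - 2 / Q n)) := by
        gcongr
        rw [critInt_eq_add hn (memLp_of_energy_lt_top hu).1]
        exact rpow_add_le hθ.1 hθ.2.le hA hAB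
    _ = (S * critInt u⁺ ^ (1 - 2 / Q n) + CBEpos n * distSq u⁺) + 2 * κ * energy u⁻
        + r * (S * critInt u⁻ ^ (1 - 2 / Q n)) := by ring
    _ ≤ energy u⁺ + 2 * κ * energy u⁻ + r * energy u⁻ := by gcongr
    _ = energy u⁺ + energy u⁻ := by
        rw [add_assoc, ← add_mul, two_mul_ofReal_add_ofReal hn, one_mul]
    _ ≤ energy u := hsplit

end CRSphere

theorem proposition2p3 (n : ℕ) (hn : 1 ≤ n) :
    CRSphere.CBE n ≥ min (CRSphere.CBEpos n / 2)
      (ENNReal.ofReal (1 - (2 : ℝ) ^ (-2 / CRSphere.Q n))) := by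
  open CRSphere in
  rcases eq_or_ne (CBEpos n) 0 with hC | hC
  · simp [hC]
  refine le_iInf₂ fun u hu => ?_
  set M := min (CBEpos n / 2) (ENNReal.ofReal (1 - (2 : ℝ) ^ (-2 / Q n)))
  have hM : M * 2 ≤ CBEpos n := ENNReal.mul_le_of_le_div (min_le_left _ _)
  have hM' : M ≤ ENNReal.ofReal (1 - (2 : ℝ) ^ (-2 / Q n)) := min_le_right _ _
  have hE : energy u < ∞ := hu.1
  have key : M * distSq u + sobConst n * eLpNorm u (ENNReal.ofReal (critExp n)) (σ n) ^ 2
      ≤ energy u := by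
    rcases le_total (critInt u⁻) (critInt u⁺) with h | h
    · exact stability_of_negPart_le hn hC hM hM' hE h
    · have := stability_of_negPart_le hn hC hM hM' (u := -u) (by rwa [energy_neg])
        (by rwa [posPart_neg, negPart_neg])
      rwa [distSq_neg, energy_neg, eLpNorm_neg] at this
  rw [quot, ENNReal.le_div_iff_mul_le (Or.inl hu.2)
    (Or.inl ((distSq_le_energy u).trans_lt hE).ne)]
  exact ENNReal.le_sub_of_add_le_right ((le_add_self.trans key).trans_lt hE).ne key
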